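/- **Proposition 3.2 (Decreasing rearrangement).** Let $d\ge 1$. For $C\subset\mathbb Z^d$ let $\Theta_d(C)=\{(x,y)\in\mathbb Z^d\times\mathbb Z^d:\ |x-y|=1,\ x\in C,\ y\notin C\}$, where $|\cdot|$ is the Euclidean norm; $\#\Theta_d(C)$ is the edge perimeter of $C$. For $s\in\{1,\dots,d\}$ and $k\in\mathbb Z$ let $S_{s,k}(C)=\{x\in C:\ x_s=k\}$, and let $P(z_1,\dots,z_d)=(z_1,\dots,z_{s-1},z_{s+1},\dots,z_d)$. *Daisies.* A tuple $(p_1,\dots,p_m)$ of positive integers is $DO1$ if it is nonincreasing and $p_1-p_m\le 1$. For $m\ge1$, its value-change position is the least $j\ge 2$ with $p_j<p_{j-1}$, or $1$ if the tuple is constant. An $m$-dimensional daisy with leading coefficients $(p_1,\dots,p_m)$, a $DO1$ tuple, is a set $Q\subset\mathbb Z^m$ which is either the box $B=\{1,\dots,p_1\}\times\dots\times\{1,\dots,p_m\}$ (a perfect daisy), or, for $m\ge 2$, a union $B\cup R'$ of the following kind: if $t$ is the value-change position of $(p_1,\dots,p_m)$, then $R'=\{z\in\mathbb Z^m:\ z_t=p_t+1,\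 (z_1,\dots,z_{t-1},z_{t+1},\dots,z_m)\in R\}$, where $R$ is an $(m-1)$-dimensional daisy whose leading coefficients $(q_1,\dots,q_{m-1})$ are entrywise at most $(p_1,\dots,p_{t-1},p_{t+1},\dots,p_m)$, with strict inequality in at least one entry. The only $0$-dimensional daisy is the one-point set $\mathbb Z^0$. *Decreasing rearrangement.* Let $C\subset\mathbb Z^d$ be bounded and nonempty and let $s\in\{1,\dots,d\}$. Let $K_s=\{k\in\mathbb Z:\ S_{s,k}(C)\neq\emptyset\}$ and $n=\#K_s$. A set $C_s\subset\mathbb Z^d$ is a decreasing rearrangement of $C$ in the direction $\mathbf e_s$ if there is a bijection $\sigma:\{1,\dots,n\}\to K_s$ with $\#S_{s,\sigma(i)}(C)\ge\#S_{s,\sigma(j)}(C)$ for all $1\le i\le j\le n$ such that $S_{s,k}(C_s)\ne\emptyset$ exactly for $k\in\{1,\dots,n\}$ and, for each such $k$, the set $P\,S_{s,k}(C_s)$ is a $(d-1)$-dimensional daisy with $\#S_{s,\sigma(k)}(C)$ elements. Then $C$ has exactly one decreasing rearrangement $C_s$ in the direction $\mathbf e_s$, and $$\#\Theta_d(C_s)\le\#\Theta_d(C).$$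 -/

import Mathlib

/-- The edge boundary of `C ⊆ ℤ^d`: ordered pairs `(x, y)` at Euclidean distance `1`
(written as squared distance `1`) with `x ∈ C` and `y ∉ C`. -/
def edgeBoundary {d : ℕ} (C : Set (Fin d → ℤ)) : Set ((Fin d → ℤ) × (Fin d → ℤ)) :=
  {e | ∑ i, (e.1 i - e.2 i) ^ 2 = 1 ∧ e.1 ∈ C ∧ e.2 ∉ C}

/-- The edge perimeter: the cardinality of the edge boundary. -/
noncomputable def edgePerimeter {d : ℕ} (C : Set (Fin d → ℤ)) : ℕ∞ :=
  (edgeBoundary C).encard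

/-- The section of `C` orthogonal to the `s`-th coordinate direction at height `k`. -/
def latticeSection {d : ℕ} (s : Fin d) (k : ℤ) (C : Set (Fin d → ℤ)) : Set (Fin d → ℤ) :=
  {x | x ∈ C ∧ x s = k}

/-- A tuple of positive integers which is nonincreasing and has oscillation at most `1`. -/
structure IsDO1 {k : ℕ} (p : Fin k → ℕ) : Prop where
  pos : ∀ i, 1 ≤ p i
  antitone : Antitone p
  osc : ∀ i j, p i ≤ p j + 1

/-- The box `{1, …, p₁} × ⋯ × {1, …, pₖ}`; it is a perfect daisy when `p` is a DO1 tuple. -/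
def daisyBox {k : ℕ} (p : Fin k → ℕ) : Set (Fin k → ℤ) :=
  {x | ∀ i, 1 ≤ x i ∧ x i ≤ (p i : ℤ)}

/-- The value-change position of a DO1 tuple: the first position whose entry is smaller than
the preceding entry, or the first position of all if the tuple is constant. -/
def valueChange {k : ℕ} (p : Fin (k + 1) → ℕ) : Fin (k + 1) :=
  if h : ∃ j : Fin k, p j.succ < p j.castSucc then (Fin.find _ h).succ else 0

/-- `TupleLT a b` says that the tuple `b` (of length `n + 1`) is larger than the tuple `a` (of
length `n`): the entries of `a` are at most those of `b` with the value-change position left out,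
and one of these inequalities is strict. -/
def TupleLT {n : ℕ} (a : Fin n → ℕ) (b : Fin (n + 1) → ℕ) : Prop :=
  (∀ i, a i ≤ b ((valueChange b).succAbove i)) ∧ ∃ i, a i < b ((valueChange b).succAbove i)

/-- `IsDaisyWith p Q`: `Q` is a `d`-dimensional daisy whose top-dimensional constituent is the
perfect daisy with coefficients `p`. Either `Q` is that perfect daisy, or `Q` is its union with
the remaining, lower-dimensional constituents. The latter form a daisy of one dimension less,
with smaller leading coefficients, placed in the hyperplane `x_s = p_s + 1`, where `s` is the
value-change position of `p`. By strictness in `TupleLT` every constituent that is added has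
dimension at least `1`. The only `0`-dimensional daisy is the one-point set. -/
inductive IsDaisyWith : {d : ℕ} → (Fin d → ℕ) → Set (Fin d → ℤ) → Prop
  | perfect {d : ℕ} (p : Fin d → ℕ) (hp : IsDO1 p) : IsDaisyWith p (daisyBox p)
  | layer {d : ℕ} (p : Fin (d + 1) → ℕ) (hp : IsDO1 p) (q : Fin d → ℕ) (R : Set (Fin d → ℤ))
      (hR : IsDaisyWith q R) (hlt : TupleLT q p) :
      IsDaisyWith p (daisyBox p ∪
        (fun x => (valueChange p).insertNth (p (valueChange p) + 1 : ℤ) x) '' R)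

/-- `Q` is a `d`-dimensional daisy. -/
def IsDaisy {d : ℕ} (Q : Set (Fin d → ℤ)) : Prop :=
  ∃ p : Fin d → ℕ, IsDaisyWith p Q

/-- `C'` is the decreasing rearrangement of `C` in the `s`-th direction: after the nonempty
sections of `C` orthogonal to that direction have been listed in order `σ` of decreasing size,
the nonempty sections of `C'` are those at heights `1, …, n`, and the projection of the section
at the `i`-th height is a daisy with as many points as the `i`-th listed section of `C`. -/
def IsDecreasingRearrangement {d : ℕ} (s : Fin (d + 1)) (C C' : Set (Fin (d + 1) → ℤ)) : Prop :=
  ∃ (n : ℕ) (σ : Fin n ≃ {k : ℤ // (latticeSection s k C).Nonempty}),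
    (∀ i j, i ≤ j →
      (latticeSection s (σ j) C).encard ≤ (latticeSection s (σ i) C).encard) ∧
    (∀ k : ℤ, (latticeSection s k C').Nonempty ↔ 1 ≤ k ∧ k ≤ n) ∧
    ∀ i : Fin n,
      IsDaisy (s.removeNth '' latticeSection s ((i : ℤ) + 1) C') ∧
      (s.removeNth '' latticeSection s ((i : ℤ) + 1) C').encard =
        (latticeSection s (σ i) C).encard

/-! A DO1 tuple of given length is determined by its sum `N`. Passing from `N` to `N + 1` lengthens
one side of the box, exactly at the value-change position, and so adds one facet. Filling each new
facet recursively by lower-dimensional daisies gives a single sequence of points, `daisySeq`, whose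
nonempty initial segments are exactly the daisies (`IsDaisyWith.exists_eq_daisy`,
`exists_isDaisyWith_daisy`). A daisy is thus determined by its cardinality, and a decreasing
rearrangement by the sorted list of section sizes; this gives existence and uniqueness.

Rearranging preserves cardinality, and the perimeter of `A` in dimension `d` is `2 * (d * #A -
innerEdges A)`, so inner edges must not decrease. Edges inside a section are bounded by the
isoperimetric inequality one dimension lower. Edges between consecutive sections number at most `#A`
minus the largest section. A stack of nested daisies reaches both bounds.

What remains is the isoperimetric inequality `innerEdges_le_daisyEdges`, by induction on dimension
and cardinality. Slice `A` in a direction with the most nonempty sections, restack the sections as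
daisies, and remove the smallest, of size `m`. The rest is bounded by induction, and
`daisyEdges_layer_le` pays for putting the `m` points back. That inequality rests on submodularity
of the edge count, applied to two daisies in opposite corners of a box (`daisyEdges_exchange`). -/

open Finset

/-! ### Boxes with nearly equal sides -/

/-- The tuple of length `d`, entry sum `N`, nonincreasing and of oscillation at most one. -/
def levelTuple (d N : ℕ) (i : Fin d) : ℕ := if (i : ℕ) < N % d then N / d + 1 else N / d

/-- The number of lattice points of the box with side lengths `levelTuple d N`. -/
def boxVolume (d N : ℕ) : ℕ := ∏ i, levelTuple d N i

/-- The index of the tuple left from `levelTuple (d + 1) N` when its value-change position is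
left out. -/
def faceIndex (d N : ℕ) : ℕ := d * (N / (d + 1)) + N % (d + 1)

/-- The position of `levelTuple (d + 1) N` whose increment yields `levelTuple (d + 1) (N + 1)`. -/
def growthPos (d N : ℕ) : Fin (d + 1) := ⟨N % (d + 1), Nat.mod_lt _ d.succ_pos⟩

theorem exists_eq_mul_add (d N : ℕ) : ∃ a j, j ≤ d ∧ N = (d + 1) * a + j :=
  ⟨N / (d + 1), N % (d + 1), Nat.lt_succ_iff.mp (Nat.mod_lt _ d.succ_pos),
    (Nat.div_add_mod _ _).symm⟩

theorem succ_mul_add_div {d a j : ℕ} (hj : j ≤ d) : ((d + 1) * a + j) / (d + 1) = a := by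
  rw [Nat.mul_add_div d.succ_pos, Nat.div_eq_of_lt (by omega), add_zero]

theorem succ_mul_add_mod {d a j : ℕ} (hj : j ≤ d) : ((d + 1) * a + j) % (d + 1) = j := by
  rw [Nat.mul_add_mod, Nat.mod_eq_of_lt (by omega)]

theorem levelTuple_mul_add {d a j : ℕ} (hj : j ≤ d) (i : Fin d) :
    levelTuple d (d * a + j) i = if (i : ℕ) < j then a + 1 else a := by
  obtain ⟨i, hi⟩ := i
  obtain ⟨d, rfl⟩ : ∃ e, d = e + 1 := ⟨d - 1, by omega⟩
  unfold levelTuple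
  rcases Nat.lt_or_ge d j with h | h
  · obtain rfl : j = d + 1 := by omega
    have : (d + 1) * a + (d + 1) = (d + 1) * (a + 1) + 0 := by ring
    rw [this, succ_mul_add_div (Nat.zero_le _), succ_mul_add_mod (Nat.zero_le _)]
    simp [hi]
  · rw [succ_mul_add_div h, succ_mul_add_mod h]

theorem boxVolume_mul_add {d a j : ℕ} (hj : j ≤ d) :
    boxVolume d (d * a + j) = (a + 1) ^ j * a ^ (d - j) := by
  obtain ⟨e, rfl⟩ := Nat.exists_eq_add_of_le hj
  unfold boxVolume
  simp only [levelTuple_mul_add hj]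
  rw [Fin.prod_univ_add]
  simp

theorem boxVolume_zero_left (N : ℕ) : boxVolume 0 N = 1 := by simp [boxVolume]

theorem boxVolume_zero_right (d : ℕ) : boxVolume (d + 1) 0 = 0 := by
  have := boxVolume_mul_add (d := d + 1) (a := 0) (j := 0) (by omega)
  simpa using this

theorem growthPos_mul_add {d a j : ℕ} (hj : j ≤ d) :
    growthPos d ((d + 1) * a + j) = ⟨j, by omega⟩ := by
  ext; exact succ_mul_add_mod hj

theorem faceIndex_mul_add {d a j : ℕ} (hj : j ≤ d) :
    faceIndex d ((d + 1) * a + j) = d * a + j := by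
  unfold faceIndex; rw [succ_mul_add_div hj, succ_mul_add_mod hj]

theorem levelTuple_growthPos (d N : ℕ) :
    levelTuple (d + 1) N (growthPos d N) = N / (d + 1) := by
  simp [levelTuple, growthPos]

theorem levelTuple_succ_growthPos (d N : ℕ) :
    levelTuple (d + 1) (N + 1) (growthPos d N) = N / (d + 1) + 1 := by
  obtain ⟨a, j, hj, rfl⟩ := exists_eq_mul_add d N
  rw [growthPos_mul_add hj, add_assoc, levelTuple_mul_add (by omega), succ_mul_add_div hj]
  simp

theorem levelTuple_succAbove (d N : ℕ) (i : Fin d) :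
    levelTuple (d + 1) N ((growthPos d N).succAbove i) = levelTuple d (faceIndex d N) i := by
  obtain ⟨a, j, hj, rfl⟩ := exists_eq_mul_add d N
  rw [growthPos_mul_add hj, faceIndex_mul_add hj, levelTuple_mul_add hj,
    levelTuple_mul_add (by omega)]
  congr 1
  grind [Fin.succAbove]

theorem levelTuple_succ_succAbove (d N : ℕ) (i : Fin d) :
    levelTuple (d + 1) (N + 1) ((growthPos d N).succAbove i) =
      levelTuple d (faceIndex d N) i := by
  obtain ⟨a, j, hj, rfl⟩ := exists_eq_mul_add d N
  rw [growthPos_mul_add hj, faceIndex_mul_add hj, add_assoc, levelTuple_mul_add (by omega),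
    levelTuple_mul_add (by omega)]
  congr 1
  grind [Fin.succAbove]

theorem boxVolume_eq_mul_face (d N : ℕ) :
    boxVolume (d + 1) N = N / (d + 1) * boxVolume d (faceIndex d N) := by
  unfold boxVolume
  rw [Fin.prod_univ_succAbove _ (growthPos d N), levelTuple_growthPos]
  simp only [levelTuple_succAbove]

/-- Only the side at `growthPos` grows, by one, so the gain is the volume of the facet orthogonal to
it. -/
theorem boxVolume_succ (d N : ℕ) :
    boxVolume (d + 1) (N + 1) = boxVolume (d + 1) N + boxVolume d (faceIndex d N) := by
  rw [boxVolume_eq_mul_face d N]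
  unfold boxVolume
  rw [Fin.prod_univ_succAbove _ (growthPos d N), levelTuple_succ_growthPos]
  simp only [levelTuple_succ_succAbove]
  ring

theorem levelTuple_mono (d : ℕ) (i : Fin d) : Monotone fun N => levelTuple d N i := by
  obtain _ | d := d
  · exact i.elim0
  refine monotone_nat_of_le_succ fun N => ?_
  rcases Fin.eq_self_or_eq_succAbove (growthPos d N) i with rfl | ⟨k, rfl⟩
  · rw [levelTuple_growthPos, levelTuple_succ_growthPos]; omega
  · rw [levelTuple_succAbove, levelTuple_succ_succAbove]

theorem boxVolume_mono (d : ℕ) : Monotone (boxVolume d) := fun _ _ h =>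
  Finset.prod_le_prod' fun i _ => levelTuple_mono d i h

theorem levelTuple_pos {d N : ℕ} (h : d ≤ N) (i : Fin d) : 1 ≤ levelTuple d N i := by
  have : 1 ≤ N / d := (Nat.one_le_div_iff i.pos).2 h
  unfold levelTuple; split_ifs <;> omega

theorem boxVolume_pos {d N : ℕ} (h : d ≤ N) : 0 < boxVolume d N :=
  Finset.prod_pos fun i _ => levelTuple_pos h i

theorem le_faceIndex {d N : ℕ} (h : d ≤ N) : d ≤ faceIndex d N := by
  obtain ⟨a, j, hj, rfl⟩ := exists_eq_mul_add d N
  rw [faceIndex_mul_add hj]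
  rcases a with _ | a
  · simpa using h
  · nlinarith

theorem boxVolume_succ_self (d : ℕ) : boxVolume (d + 1) (d + 1) = 1 := by
  have := boxVolume_mul_add (d := d + 1) (a := 1) (j := 0) (by omega)
  simpa using this

theorem faceIndex_succ_self (d : ℕ) : faceIndex d (d + 1) = d := by
  have := faceIndex_mul_add (d := d) (a := 1) (j := 0) (by omega)
  simpa using this

theorem le_boxVolume (d n : ℕ) : n ≤ boxVolume (d + 1) (d + n) := by
  induction n with
  | zero => omega
  | succ n ih =>
    have := boxVolume_pos (le_faceIndex (Nat.le_add_right d n))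
    rw [← add_assoc, boxVolume_succ]; omega

theorem exists_lt_boxVolume (d n : ℕ) : ∃ N, n < boxVolume (d + 1) (N + 1) :=
  ⟨d + n, le_boxVolume d (n + 1)⟩

/-! ### The enumeration of points and its initial segments -/

/-- The index of the largest box that is no larger than `n`. -/
def boxLevel (d n : ℕ) : ℕ := Nat.find (exists_lt_boxVolume d n)

theorem boxVolume_boxLevel_le (d n : ℕ) : boxVolume (d + 1) (boxLevel d n) ≤ n := by
  rcases h : boxLevel d n with _ | N
  · rw [boxVolume_zero_right]; omega
  · exact not_lt.mp (Nat.find_min (exists_lt_boxVolume d n) (show N < boxLevel d n by omega))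

theorem exists_eq_boxVolume_add (d n : ℕ) :
    ∃ N r, r < boxVolume d (faceIndex d N) ∧ n = boxVolume (d + 1) N + r := by
  have h1 := boxVolume_boxLevel_le d n
  have h2 : n < boxVolume (d + 1) (boxLevel d n + 1) := Nat.find_spec (exists_lt_boxVolume d n)
  rw [boxVolume_succ] at h2
  exact ⟨boxLevel d n, n - boxVolume (d + 1) (boxLevel d n), by omega, by omega⟩

theorem boxLevel_eq {d N r : ℕ} (hr : r < boxVolume d (faceIndex d N)) :
    boxLevel d (boxVolume (d + 1) N + r) = N := by
  refine (Nat.find_eq_iff _).2 ⟨by rw [boxVolume_succ]; omega, fun M hM => ?_⟩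
  have := boxVolume_mono (d + 1) (show M + 1 ≤ N from hM)
  omega

/-- An enumeration of the lattice points with positive coordinates (for `d ≥ 1`) whose initial
segments are the daisies. -/
def daisySeq : (d : ℕ) → ℕ → Fin d → ℤ
  | 0, _ => Fin.elim0
  | d + 1, n => (growthPos d (boxLevel d n)).insertNth (α := fun _ => ℤ)
      ((boxLevel d n / (d + 1) : ℕ) + 1 : ℤ)
      (daisySeq d (n - boxVolume (d + 1) (boxLevel d n)))

theorem daisySeq_add {d N r : ℕ} (hr : r < boxVolume d (faceIndex d N)) :
    daisySeq (d + 1) (boxVolume (d + 1) N + r) =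
      (growthPos d N).insertNth (α := fun _ => ℤ) ((N / (d + 1) : ℕ) + 1 : ℤ) (daisySeq d r) := by
  rw [daisySeq, boxLevel_eq hr, Nat.add_sub_cancel_left]

/-- The initial segment of length `n` of `daisySeq d`. -/
def daisy (d n : ℕ) : Finset (Fin d → ℤ) := (range n).image (daisySeq d)

theorem daisy_mono (d : ℕ) : Monotone (daisy d) := fun _ _ h =>
  image_subset_image (range_subset_range.2 h)

theorem daisy_zero_right (d : ℕ) : daisy d 0 = ∅ := by simp [daisy]

/-- The box with side lengths `levelTuple d N`, as a finite set. -/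
noncomputable def levelBox (d N : ℕ) : Finset (Fin d → ℤ) := Icc 1 fun i => (levelTuple d N i : ℤ)

theorem mem_levelBox {d N : ℕ} {x : Fin d → ℤ} :
    x ∈ levelBox d N ↔ ∀ i, 1 ≤ x i ∧ x i ≤ levelTuple d N i := by
  simp [levelBox, Pi.le_def, forall_and]

theorem coe_levelBox (d N : ℕ) : (levelBox d N : Set (Fin d → ℤ)) = daisyBox (levelTuple d N) := by
  ext x; rw [mem_coe, mem_levelBox]; rfl

theorem card_levelBox (d N : ℕ) : #(levelBox d N) = boxVolume d N := by
  simp [levelBox, Pi.card_Icc, boxVolume]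

theorem mem_image_insertNth {d : ℕ} {s : Fin (d + 1)} {k : ℤ} {A : Finset (Fin d → ℤ)}
    {x : Fin (d + 1) → ℤ} :
    x ∈ A.image (s.insertNth (α := fun _ => ℤ) k) ↔ x s = k ∧ s.removeNth x ∈ A := by
  rw [mem_image]
  constructor
  · rintro ⟨y, hy, rfl⟩; simpa using hy
  · rintro ⟨rfl, h⟩; exact ⟨_, h, Fin.insertNth_self_removeNth s x⟩

theorem levelBox_succ (d N : ℕ) :
    levelBox (d + 1) (N + 1) = levelBox (d + 1) N ∪ (levelBox d (faceIndex d N)).image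
      ((growthPos d N).insertNth (α := fun _ => ℤ) ((N / (d + 1) : ℕ) + 1 : ℤ)) := by
  ext x
  rw [mem_union, mem_image_insertNth]
  simp only [mem_levelBox, Fin.forall_iff_succAbove (growthPos d N), levelTuple_growthPos,
    levelTuple_succ_growthPos, levelTuple_succAbove, levelTuple_succ_succAbove, Fin.removeNth]
  generalize N / (d + 1) = a
  constructor
  · rintro ⟨⟨h1, h2⟩, h3⟩
    rcases lt_or_eq_of_le h2 with h | h
    · exact Or.inl ⟨⟨h1, by push_cast at h; omega⟩, h3⟩
    · exact Or.inr ⟨by rw [h]; push_cast; rfl, h3⟩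
  · rintro (⟨⟨h1, h2⟩, h3⟩ | ⟨h, h3⟩)
    · exact ⟨⟨h1, by push_cast; omega⟩, h3⟩
    · exact ⟨⟨by rw [h]; omega, by rw [h]; push_cast; omega⟩, h3⟩

theorem daisy_add_eq_union {d N r : ℕ} (hr : r ≤ boxVolume d (faceIndex d N)) :
    daisy (d + 1) (boxVolume (d + 1) N + r) = daisy (d + 1) (boxVolume (d + 1) N) ∪
      (daisy d r).image
        ((growthPos d N).insertNth (α := fun _ => ℤ) ((N / (d + 1) : ℕ) + 1 : ℤ)) := by
  unfold daisy
  rw [range_add_eq_union, image_union, image_image]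
  congr 1
  rw [map_eq_image, image_image]
  refine image_congr fun k hk => ?_
  exact daisySeq_add (lt_of_lt_of_le (mem_range.mp hk) hr)

/-- Double induction: the points added between levels `N` and `N + 1` form a lower-dimensional daisy
of full facet volume, which is the whole facet by induction on the dimension. -/
theorem daisy_boxVolume (d N : ℕ) : daisy d (boxVolume d N) = levelBox d N := by
  induction d generalizing N with
  | zero =>
    ext x
    simp [mem_levelBox, daisy, boxVolume_zero_left, Subsingleton.elim x (daisySeq 0 0)]
  | succ d ihd =>
    induction N with
    | zero =>
      rw [boxVolume_zero_right, daisy_zero_right, eq_comm, ← card_eq_zero, card_levelBox,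
        boxVolume_zero_right]
    | succ N ih => rw [boxVolume_succ, daisy_add_eq_union le_rfl, ih, ihd, levelBox_succ]

theorem daisy_add {d N r : ℕ} (hr : r ≤ boxVolume d (faceIndex d N)) :
    daisy (d + 1) (boxVolume (d + 1) N + r) = levelBox (d + 1) N ∪
      (daisy d r).image
        ((growthPos d N).insertNth (α := fun _ => ℤ) ((N / (d + 1) : ℕ) + 1 : ℤ)) := by
  rw [daisy_add_eq_union hr, daisy_boxVolume]

/-- An initial segment filling a box has as many points as indices, so the enumeration is injective
on it; such segments are arbitrarily long. -/
theorem daisySeq_injective (d : ℕ) : Function.Injective (daisySeq (d + 1)) := by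
  intro m n h
  have hcard : #(daisy (d + 1) (boxVolume (d + 1) (d + (m + n + 1)))) =
      #(range (boxVolume (d + 1) (d + (m + n + 1)))) := by
    rw [daisy_boxVolume, card_levelBox, card_range]
  have := le_boxVolume d (m + n + 1)
  exact card_image_iff.mp hcard (by simp; omega) (by simp; omega) h

theorem card_daisy_succ (d n : ℕ) : #(daisy (d + 1) n) = n := by
  rw [daisy, card_image_of_injective _ (daisySeq_injective d), card_range]

theorem card_daisy_zero {n : ℕ} (hn : n ≤ 1) : #(daisy 0 n) = n := by
  interval_cases n <;> simp [daisy]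

/-- Daisies are closed under decreasing coordinates. -/
theorem daisy_lower {d n : ℕ} {x y : Fin d → ℤ} (hx : x ∈ daisy d n) (hyx : y ≤ x)
    (hy : ∀ i, 1 ≤ y i) : y ∈ daisy d n := by
  induction d generalizing n with
  | zero => rwa [Subsingleton.elim y x]
  | succ d ih =>
    obtain ⟨N, r, hr, rfl⟩ := exists_eq_boxVolume_add d n
    rw [daisy_add hr.le, mem_union, mem_image_insertNth] at hx ⊢
    rcases hx with hx | ⟨hx1, hx2⟩
    · rw [mem_levelBox] at hx ⊢
      exact Or.inl fun i => ⟨hy i, (hyx i).trans (hx i).2⟩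
    · rcases (hyx (growthPos d N)).lt_or_eq with h | h
      -- A point dropping below the extra layer lands in the box, because the layer projects into
      -- the facet.
      · left
        have hbox := daisy_mono d hr.le hx2
        rw [daisy_boxVolume, mem_levelBox] at hbox
        rw [mem_levelBox, Fin.forall_iff_succAbove (growthPos d N)]
        refine ⟨⟨hy _, ?_⟩, fun i => ⟨hy _, ?_⟩⟩
        · rw [levelTuple_growthPos]
          rw [hx1] at h
          exact Int.lt_add_one_iff.mp h
        · rw [levelTuple_succAbove]; exact (hyx _).trans (hbox i).2
      · exact Or.inr ⟨h.trans hx1, ih hx2 (fun i => hyx _) fun i => hy _⟩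

theorem one_le_of_mem_daisy {d n : ℕ} {x : Fin d → ℤ} (hx : x ∈ daisy d n) (i : Fin d) :
    1 ≤ x i := by
  obtain _ | d := d
  · exact i.elim0
  · have := daisy_mono (d + 1) (le_boxVolume d n) hx
    rw [daisy_boxVolume, mem_levelBox] at this
    exact (this i).1

/-! ### Inner edges -/

/-- The number of (unordered) pairs of neighbouring points in a finite set of lattice points. -/
def innerEdges {d : ℕ} (A : Finset (Fin d → ℤ)) : ℕ :=
  ∑ i, #{x ∈ A | x + Pi.single i 1 ∈ A}

/-- Submodularity: an edge of `A` or of `B` is an edge of the union, and an edge of both is one of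
the intersection. -/
theorem innerEdges_add_le {d : ℕ} (A B : Finset (Fin d → ℤ)) :
    innerEdges A + innerEdges B ≤ innerEdges (A ∪ B) + innerEdges (A ∩ B) := by
  unfold innerEdges
  rw [← sum_add_distrib, ← sum_add_distrib]
  refine sum_le_sum fun i _ => ?_
  rw [← card_union_add_card_inter]
  refine add_le_add (card_le_card fun x => ?_) (card_le_card fun x => ?_) <;>
    simp only [mem_union, mem_inter, mem_filter] <;> tauto

theorem innerEdges_image_sub {d : ℕ} (c : Fin d → ℤ) (A : Finset (Fin d → ℤ)) :
    innerEdges (A.image (c - ·)) = innerEdges A := by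
  have hmem : ∀ x, x ∈ A.image (c - ·) ↔ c - x ∈ A := fun x => by
    rw [mem_image]
    exact ⟨by rintro ⟨y, hy, rfl⟩; simpa using hy, fun h => ⟨_, h, by simp⟩⟩
  refine sum_congr rfl fun i _ => ?_
  refine card_nbij' (fun x => c - x - Pi.single i 1) (fun x => c - x - Pi.single i 1)
    ?_ ?_ ?_ ?_
  · intro x hx
    simp only [coe_filter, Set.mem_ofPred_eq, hmem] at hx ⊢
    exact ⟨by rw [sub_sub]; exact hx.2, by simpa using hx.1⟩
  · intro x hx
    simp only [coe_filter, Set.mem_ofPred_eq, hmem] at hx ⊢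
    exact ⟨by convert hx.2 using 1; abel, by convert hx.1 using 1; abel⟩
  · intro x _; simp; abel
  · intro x _; simp; abel

theorem innerEdges_eq_zero_of_card_le_one {d : ℕ} {A : Finset (Fin d → ℤ)} (h : #A ≤ 1) :
    innerEdges A = 0 := by
  refine sum_eq_zero fun i _ => ?_
  rw [card_eq_zero, filter_eq_empty_iff]
  intro x hx hx'
  have := congrFun (card_le_one.mp h _ hx _ hx') i
  simp at this

/-- The number of inner edges of the daisy with `n` points. -/
def daisyEdges (d n : ℕ) : ℕ := ∑ k ∈ range n, #{i | 1 < daisySeq d k i}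

theorem daisyEdges_zero_left (n : ℕ) : daisyEdges 0 n = 0 := by simp [daisyEdges]

theorem daisyEdges_zero_right (d : ℕ) : daisyEdges d 0 = 0 := by simp [daisyEdges]

/-- Since `d + 1 ≤ N`, the box has no empty side, so each point of the new layer has one edge down
to the box besides its edges inside the layer. -/
theorem daisyEdges_add {d N r : ℕ} (hN : d + 1 ≤ N) (hr : r ≤ boxVolume d (faceIndex d N)) :
    daisyEdges (d + 1) (boxVolume (d + 1) N + r) =
      daisyEdges (d + 1) (boxVolume (d + 1) N) + (r + daisyEdges d r) := by
  unfold daisyEdges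
  rw [sum_range_add]
  congr 1
  have : r = ∑ _k ∈ range r, 1 := by simp
  conv_rhs => enter [1]; rw [this]
  rw [← sum_add_distrib]
  refine sum_congr rfl fun k hk => ?_
  rw [daisySeq_add (lt_of_lt_of_le (mem_range.mp hk) hr)]
  have hpos : 1 ≤ N / (d + 1) := (Nat.one_le_div_iff d.succ_pos).2 hN
  simp only [card_filter]
  rw [Fin.sum_univ_succAbove _ (growthPos d N)]
  congr 1
  · rw [if_pos]; rw [Fin.insertNth_apply_same]; omega
  · simp

/-- Charge each edge to its upper endpoint: as daisies are closed downwards, a point has a lower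
neighbour in direction `i` exactly when its `i`-th coordinate exceeds `1`. -/
theorem innerEdges_daisy {d n : ℕ} (h : #(daisy d n) = n) :
    innerEdges (daisy d n) = daisyEdges d n := by
  have hsum : daisyEdges d n = ∑ x ∈ daisy d n, #{i | 1 < x i} := by
    unfold daisyEdges daisy
    rw [sum_image]
    exact card_image_iff.mp (by rw [card_range]; exact h)
  rw [hsum]
  simp only [card_filter]
  rw [sum_comm]
  refine sum_congr rfl fun i _ => ?_
  rw [← card_filter]
  refine card_nbij' (· + Pi.single i 1) (· - Pi.single i 1) ?_ ?_ ?_ ?_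
  · intro x hx
    simp only [coe_filter, Set.mem_ofPred_eq] at hx ⊢
    refine ⟨hx.2, ?_⟩
    have := one_le_of_mem_daisy hx.1 i
    simp; omega
  · intro x hx
    simp only [coe_filter, Set.mem_ofPred_eq] at hx ⊢
    refine ⟨daisy_lower hx.1 ?_ fun k => ?_, by simpa using hx.1⟩
    · intro k
      by_cases hk : k = i
      · subst hk; simp
      · simp [hk]
    · by_cases hk : k = i
      · subst hk; simp; omega
      · simp [hk]; exact one_le_of_mem_daisy hx.1 k
  · intro x _; simp
  · intro x _; simp

/-! ### Slicing a set orthogonally to a direction -/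

section Sections

variable {d : ℕ} (s : Fin (d + 1))

/-- The projected section of a finite set at height `k` in direction `s`. -/
noncomputable def sectionAt (k : ℤ) (A : Finset (Fin (d + 1) → ℤ)) : Finset (Fin d → ℤ) :=
  A.preimage (s.insertNth (α := fun _ => ℤ) k) fun y _ z _ h => by
    simpa using congrArg s.removeNth h

variable {s}

theorem mem_sectionAt {k : ℤ} {A : Finset (Fin (d + 1) → ℤ)} {y : Fin d → ℤ} :
    y ∈ sectionAt s k A ↔ s.insertNth (α := fun _ => ℤ) k y ∈ A :=
  mem_preimage

theorem card_sectionAt (k : ℤ) (A : Finset (Fin (d + 1) → ℤ)) :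
    #(sectionAt s k A) = #{x ∈ A | x s = k} := by
  refine card_nbij' (s.insertNth (α := fun _ => ℤ) k) s.removeNth ?_ ?_ ?_ ?_
  · intro y hy
    simpa [mem_sectionAt] using hy
  · intro x hx
    simp only [coe_filter, Set.mem_ofPred_eq] at hx
    rw [mem_coe, mem_sectionAt, ← hx.2, Fin.insertNth_self_removeNth]
    exact hx.1
  · intro y _; simp
  · intro x hx
    simp only [coe_filter, Set.mem_ofPred_eq] at hx
    rw [← hx.2, Fin.insertNth_self_removeNth]

theorem sectionAt_nonempty_iff {k : ℤ} {A : Finset (Fin (d + 1) → ℤ)} :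
    (sectionAt s k A).Nonempty ↔ k ∈ A.image (· s) := by
  rw [← card_pos, card_sectionAt, card_pos, mem_image]
  simp [Finset.Nonempty]

theorem sum_card_sectionAt {A : Finset (Fin (d + 1) → ℤ)} {K : Finset ℤ}
    (hK : ∀ x ∈ A, x s ∈ K) : ∑ k ∈ K, #(sectionAt s k A) = #A := by
  simp only [card_sectionAt]
  exact (card_eq_sum_card_fiberwise hK).symm

theorem insertNth_add_single_self (k : ℤ) (y : Fin d → ℤ) :
    s.insertNth (α := fun _ => ℤ) k y + Pi.single s 1 =
      s.insertNth (α := fun _ => ℤ) (k + 1) y := by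
  ext i
  rcases Fin.eq_self_or_eq_succAbove s i with rfl | ⟨i, rfl⟩ <;> simp

theorem insertNth_add_single_succAbove (k : ℤ) (y : Fin d → ℤ) (i : Fin d) :
    s.insertNth (α := fun _ => ℤ) k y + Pi.single (s.succAbove i) 1 =
      s.insertNth (α := fun _ => ℤ) k (y + Pi.single i 1) := by
  ext l
  rcases Fin.eq_self_or_eq_succAbove s l with rfl | ⟨l, rfl⟩
  · simp [(Fin.succAbove_ne _ _).symm]
  · simp [Pi.single_apply]

theorem innerEdges_eq_sum_sectionAt {A : Finset (Fin (d + 1) → ℤ)} {K : Finset ℤ}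
    (hK : ∀ x ∈ A, x s ∈ K) :
    innerEdges A = ∑ k ∈ K, innerEdges (sectionAt s k A) +
      ∑ k ∈ K, #(sectionAt s k A ∩ sectionAt s (k + 1) A) := by
  unfold innerEdges
  rw [Fin.sum_univ_succAbove _ s, add_comm, sum_comm]
  congr 1
  · refine sum_congr rfl fun i _ => ?_
    rw [← sum_card_sectionAt (s := s) (K := K) fun x hx => hK x (mem_filter.mp hx).1]
    refine sum_congr rfl fun k _ => congrArg card ?_
    ext y
    simp [mem_sectionAt, insertNth_add_single_succAbove]
  · rw [← sum_card_sectionAt (s := s) (K := K) fun x hx => hK x (mem_filter.mp hx).1]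
    refine sum_congr rfl fun k _ => congrArg card ?_
    ext y
    simp [mem_sectionAt, insertNth_add_single_self]

/-- Bound the overlap of two consecutive sections by the lower one below `k₀` and by the upper one
from `k₀` on; the section at `k₀` is never charged. -/
theorem sum_card_inter_add_card_le {A : Finset (Fin (d + 1) → ℤ)} {K : Finset ℤ}
    (hK : ∀ x ∈ A, x s ∈ K) {k₀ : ℤ} (hk₀ : k₀ ∈ K) :
    ∑ k ∈ K, #(sectionAt s k A ∩ sectionAt s (k + 1) A) + #(sectionAt s k₀ A) ≤ #A := by
  classical
  rw [← sum_card_sectionAt hK, ← sum_filter_add_sum_filter_not K (· < k₀),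
    ← sum_filter_add_sum_filter_not K (· < k₀) fun k => #(sectionAt s k A), add_assoc]
  refine add_le_add (sum_le_sum fun k _ => card_le_card inter_subset_left) ?_
  have hk₀' : k₀ ∈ ({k ∈ K | ¬ k < k₀} : Finset ℤ) := by simp [hk₀]
  rw [← sum_erase_add _ (fun k => #(sectionAt s k A)) hk₀']
  refine Nat.add_le_add_right ?_ _
  calc ∑ k ∈ K with ¬ k < k₀, #(sectionAt s k A ∩ sectionAt s (k + 1) A)
      ≤ ∑ k ∈ K with ¬ k < k₀, #(sectionAt s (k + 1) A) :=
        sum_le_sum fun k _ => card_le_card inter_subset_right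
    _ = ∑ k ∈ ({k ∈ K | ¬ k < k₀} : Finset ℤ).image (· + 1), #(sectionAt s k A) := by
        rw [sum_image]; exact fun a _ b _ h => by simpa using h
    _ ≤ _ := by
        refine sum_le_sum_of_ne_zero fun k hk hne => ?_
        have := sectionAt_nonempty_iff.mp (card_pos.mp (Nat.pos_of_ne_zero hne))
        obtain ⟨x, hx, rfl⟩ := mem_image.mp this
        obtain ⟨l, hl, hlx⟩ := mem_image.mp hk
        rw [mem_filter] at hl
        simp only [mem_erase, mem_filter]
        exact ⟨by omega, hK x hx, by omega⟩

end Sections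

/-! ### Inequalities for the edge counts of daisies -/

theorem card_daisy_card {d : ℕ} (B : Finset (Fin d → ℤ)) : #(daisy d #B) = #B := by
  obtain _ | d := d
  · exact card_daisy_zero (card_le_one.2 fun _ _ _ _ => Subsingleton.elim _ _)
  · exact card_daisy_succ d _

/-- If daisies maximize the number of inner edges, then points of two daisies contained in a
common box can be moved from the one to the other until the first fills the box or the second is
exhausted. -/
theorem daisyEdges_exchange {d N : ℕ}
    (hiso : ∀ A : Finset (Fin (d + 1) → ℤ), innerEdges A ≤ daisyEdges (d + 1) #A) {x y : ℕ}
    (hx : x ≤ boxVolume (d + 1) N) (hy : y ≤ boxVolume (d + 1) N) :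
    daisyEdges (d + 1) x + daisyEdges (d + 1) y ≤
      daisyEdges (d + 1) (min (x + y) (boxVolume (d + 1) N)) +
        daisyEdges (d + 1) (x + y - boxVolume (d + 1) N) := by
  induction hk : boxVolume (d + 1) N - x using Nat.strong_induction_on generalizing x y with
  | _ k ih =>
  subst hk
  rcases hx.eq_or_lt with rfl | hx'
  · rw [min_eq_right (by omega), Nat.add_sub_cancel_left]
  rcases y.eq_zero_or_pos with rfl | hy'
  · rw [add_zero, min_eq_left hx, Nat.sub_eq_zero_of_le hx]
  -- `c` is the top corner of the box; reflecting the second daisy through the centre of the box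
  -- puts it in that corner.
  set c : Fin (d + 1) → ℤ := fun i => levelTuple (d + 1) N i with hc
  set A := daisy (d + 1) x with hA
  set B := (daisy (d + 1) y).image (c + 1 - ·) with hB
  have hAbox : A ⊆ levelBox (d + 1) N := by
    rw [← daisy_boxVolume]; exact daisy_mono _ hx
  have hBbox : B ⊆ levelBox (d + 1) N := by
    intro z hz
    obtain ⟨w, hw, rfl⟩ := mem_image.mp hz
    have hw := daisy_mono _ hy hw
    rw [daisy_boxVolume, mem_levelBox] at hw
    refine mem_levelBox.2 fun i => ?_
    have := hw i
    simp only [hc, Pi.sub_apply, Pi.add_apply, Pi.one_apply]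
    omega
  have hcA : c ∉ A := by
    intro h
    have : levelBox (d + 1) N ⊆ A := fun z hz => by
      rw [mem_levelBox] at hz
      exact daisy_lower h (fun i => (hz i).2) fun i => (hz i).1
    have := card_le_card this
    rw [card_levelBox, card_daisy_succ] at this
    omega
  have hcB : c ∈ B := by
    obtain ⟨w, hw⟩ : (daisy (d + 1) y).Nonempty := by
      rw [← card_pos, card_daisy_succ]; exact hy'
    exact mem_image.2 ⟨1, daisy_lower hw (fun i => one_le_of_mem_daisy hw i) fun i => le_rfl,
      by simp⟩
  have hcardB : #B = y := by
    rw [hB, card_image_of_injective _ sub_right_injective, card_daisy_succ]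
  have hadd : #(A ∪ B) + #(A ∩ B) = x + y := by
    rw [card_union_add_card_inter, hcardB, card_daisy_succ]
  -- Strict progress for the induction: the corner `c` lies in `B` but not in `A`.
  have hlt : x < #(A ∪ B) := by
    rw [← card_daisy_succ d x]
    exact card_lt_card (Finset.ssubset_iff_subset_ne.2 ⟨subset_union_left, fun h =>
      hcA (by rw [hA, h]; exact mem_union_right _ hcB)⟩)
  have hle : #(A ∪ B) ≤ boxVolume (d + 1) N := by
    rw [← card_levelBox]; exact card_le_card (union_subset hAbox hBbox)
  calc daisyEdges (d + 1) x + daisyEdges (d + 1) y = innerEdges A + innerEdges B := by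
        rw [hB, innerEdges_image_sub, innerEdges_daisy (card_daisy_succ d y),
          innerEdges_daisy (card_daisy_succ d x)]
    _ ≤ innerEdges (A ∪ B) + innerEdges (A ∩ B) := innerEdges_add_le A B
    _ ≤ daisyEdges (d + 1) #(A ∪ B) + daisyEdges (d + 1) #(A ∩ B) :=
        add_le_add (hiso _) (hiso _)
    _ ≤ _ := by
        rw [← hadd]
        exact ih _ (by omega) hle (by omega) rfl

/-- Superadditivity is the exchange inequality in a box large enough to hold all `x + y` points. -/
theorem daisyEdges_add_le {d : ℕ}
    (hiso : ∀ A : Finset (Fin (d + 1) → ℤ), innerEdges A ≤ daisyEdges (d + 1) #A) (x y : ℕ) :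
    daisyEdges (d + 1) x + daisyEdges (d + 1) y ≤ daisyEdges (d + 1) (x + y) := by
  have hb := le_boxVolume d (x + y)
  have := daisyEdges_exchange hiso (N := d + (x + y)) (x := x) (y := y) (by omega) (by omega)
  rwa [min_eq_left hb, Nat.sub_eq_zero_of_le hb, daisyEdges_zero_right, add_zero] at this

theorem daisyEdges_one (n : ℕ) : daisyEdges 1 (n + 1) = n := by
  have hbox : ∀ N, boxVolume 1 N = N := fun N => by
    have := boxVolume_mul_add (d := 1) (a := N) (j := 0) (by omega)
    simpa using this
  induction n with
  | zero =>
    rw [← innerEdges_daisy (card_daisy_succ 0 _)]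
    exact innerEdges_eq_zero_of_card_le_one (card_daisy_succ 0 _).le
  | succ n ih =>
    have := daisyEdges_add (d := 0) (N := n + 1) (r := 1) (by omega)
      (by rw [boxVolume_zero_left])
    rwa [hbox, ih, daisyEdges_zero_left] at this

/-- Splitting off a layer of `m` points: the number of inner edges of a daisy is at least that of
a smaller daisy with a lower-dimensional daisy of `m` points put on a facet, provided `m` is not
too large. -/
theorem daisyEdges_layer_le {d : ℕ}
    (hiso : ∀ e, e ≤ d → ∀ A : Finset (Fin e → ℤ), innerEdges A ≤ daisyEdges e #A)
    {k m n : ℕ} (hmk : m ≤ k ^ d) (hkm : k * m ≤ n) (hmn : m < n) :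
    daisyEdges (d + 1) (n - m) + (m + daisyEdges d m) ≤ daisyEdges (d + 1) n := by
  induction d generalizing k m n with
  | zero =>
    rw [pow_zero] at hmk
    obtain ⟨n, rfl⟩ : ∃ n', n = n' + 1 := ⟨n - 1, by omega⟩
    interval_cases m
    · simp [daisyEdges_zero_left]
    · obtain ⟨n, rfl⟩ : ∃ n', n = n' + 1 := ⟨n - 1, by omega⟩
      rw [Nat.add_sub_cancel, daisyEdges_one, daisyEdges_one, daisyEdges_zero_left]
  | succ d ih =>
    have hiso' := hiso (d + 1) le_rfl
    obtain ⟨N, r, hr, rfl⟩ := exists_eq_boxVolume_add (d + 1) n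
    have hN : d + 2 ≤ N := by
      by_contra! h
      have h1 := boxVolume_mono (d + 1 + 1) (show N + 1 ≤ d + 1 + 1 by omega)
      rw [boxVolume_succ_self, boxVolume_succ] at h1
      omega
    rw [daisyEdges_add hN hr.le]
    -- If the outermost layer has at least `m` points, they are taken from it and superadditivity
    -- suffices.
    rcases le_or_gt m r with hmr | hmr
    · have h1 : boxVolume (d + 1 + 1) N + r - m = boxVolume (d + 1 + 1) N + (r - m) := by omega
      have h2 := daisyEdges_add_le hiso' (r - m) m
      rw [Nat.sub_add_cancel hmr] at h2
      rw [h1, daisyEdges_add hN (by omega)]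
      omega
    obtain ⟨M, rfl⟩ : ∃ M, N = M + 1 := ⟨N - 1, by omega⟩
    have hM : d + 2 ≤ M := by
      by_contra! h
      obtain rfl : M = d + 1 := by omega
      rw [boxVolume_succ_self] at hmn
      rw [faceIndex_succ_self, boxVolume_succ_self] at hr
      omega
    have hvol := boxVolume_succ (d + 1) M
    set b := boxVolume (d + 1) (faceIndex (d + 1) M) with hb
    -- Undo the last facet of `b` points as well: both daisies then consist of the box of level `M`
    -- and one layer (on the right a full facet, followed by the layer of `r` points), so the claim
    -- drops by one dimension.
    have hmain : m ≤ b + r →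
        daisyEdges (d + 1) (b + r - m) + daisyEdges (d + 1) m ≤
          daisyEdges (d + 1) b + daisyEdges (d + 1) r →
        daisyEdges (d + 1 + 1) (boxVolume (d + 1 + 1) (M + 1) + r - m) +
            (m + daisyEdges (d + 1) m) ≤
          daisyEdges (d + 1 + 1) (boxVolume (d + 1 + 1) (M + 1)) + (r + daisyEdges (d + 1) r) := by
      intro h1 h2
      have h3 : boxVolume (d + 1 + 1) (M + 1) + r - m = boxVolume (d + 1 + 1) M + (b + r - m) := by
        rw [hvol]; omega
      rw [h3, hvol, daisyEdges_add hM (by omega), daisyEdges_add hM le_rfl, ← hb]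
      omega
    rcases le_or_gt m b with hmb | hmb
    · refine hmain (by omega) ?_
      have := daisyEdges_exchange hiso' (N := faceIndex (d + 1) M) (x := m) (y := b + r - m)
        hmb (by omega)
      rw [← hb, min_eq_right (by omega), show m + (b + r - m) - b = r by omega] at this
      omega
    obtain ⟨a, j, hj, haj⟩ := exists_eq_mul_add (d + 1) M
    rw [haj, faceIndex_mul_add hj, boxVolume_mul_add hj] at hb
    rw [haj] at hM
    -- `k` exceeds the smallest side of the box of level `M + 1`
    have hpow : a ^ (d + 1) ≤ (a + 1) ^ j * a ^ (d + 1 - j) := by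
      calc a ^ (d + 1) = a ^ j * a ^ (d + 1 - j) := by rw [← pow_add]; congr 1; omega
        _ ≤ _ := Nat.mul_le_mul_right _ (Nat.pow_le_pow_left (by omega) _)
    have ha1 : a + 1 ≤ k := by
      by_contra! h
      have h1 : k ^ (d + 1) ≤ a ^ (d + 1) := Nat.pow_le_pow_left (by omega) _
      omega
    have hvb : boxVolume (d + 1 + 1) (M + 1) = (a + 1) * b := by
      rw [haj, add_assoc _ j, boxVolume_mul_add (by omega), hb,
        show d + 1 + 1 - (j + 1) = d + 1 - j by omega]
      ring
    -- Otherwise the box of level `M + 1` is a cube of side `a + 1` and `m > b = (a + 1) ^ (d + 1)`.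
    -- Then `k ≥ a + 2`, so `k * m` exceeds `(a + 1) * b + r`, since `r < b`.
    have hjd : j < d + 1 := by
      by_contra! h
      obtain rfl : j = d + 1 := by omega
      have hMM : M + 1 = (d + 1 + 1) * (a + 1) + 0 := by rw [haj]; ring
      have hk2 : a + 1 + 1 ≤ k := by
        by_contra! h
        have h1 : k ^ (d + 1) ≤ (a + 1) ^ (d + 1) := Nat.pow_le_pow_left (by omega) _
        simp only [Nat.sub_self, pow_zero, mul_one] at hb
        omega
      rw [hMM, faceIndex_mul_add (by omega), boxVolume_mul_add (by omega)] at hr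
      simp only [Nat.sub_self, pow_zero, mul_one, one_mul, Nat.sub_zero] at hb hr
      rw [← hb] at hr
      rw [hvb] at hkm
      have h1 : (a + 1 + 1) * m ≤ k * m := Nat.mul_le_mul_right _ hk2
      nlinarith
    -- When `m > b`, the excess `l` is itself a layer on the box of `b` points; the induction
    -- hypothesis splits `l` points off the daisy with `r` points, with `a + 1` in place of `k`.
    obtain ⟨l, rfl⟩ : ∃ l, m = b + l := ⟨m - b, by omega⟩
    have hl : (a + 1) * l ≤ r := by
      have h1 : (a + 1) * (b + l) ≤ k * (b + l) := Nat.mul_le_mul_right _ ha1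
      rw [hvb] at hkm
      nlinarith
    have hpos : 1 ≤ a := by
      by_contra! h
      obtain rfl : a = 0 := by omega
      omega
    have hlr : l < r := by nlinarith
    have hface : boxVolume (d + 1) (faceIndex (d + 1) (M + 1)) =
        (a + 1) * ((a + 1) ^ j * a ^ (d - j)) := by
      rw [haj, add_assoc _ j, faceIndex_mul_add (by omega), boxVolume_mul_add (by omega),
        show d + 1 - (j + 1) = d - j by omega]
      ring
    have hl2 : l ≤ (a + 1) ^ j * a ^ (d - j) := by
      rw [hface] at hr
      exact (Nat.lt_of_mul_lt_mul_left (hl.trans_lt hr)).le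
    have hl3 : l ≤ (a + 1) ^ d := by
      calc l ≤ (a + 1) ^ j * a ^ (d - j) := hl2
        _ ≤ (a + 1) ^ j * (a + 1) ^ (d - j) :=
          Nat.mul_le_mul_left _ (Nat.pow_le_pow_left (by omega) _)
        _ = (a + 1) ^ d := by rw [← pow_add]; congr 1; omega
    refine hmain (by omega) ?_
    have h1 := ih (fun e he => hiso e (by omega)) (k := a + 1) (m := l) (n := r) hl3 hl hlr
    have h2 := daisyEdges_add (d := d) (N := (d + 1) * a + j) (r := l) (by nlinarith)
      (by rw [faceIndex_mul_add (by omega), boxVolume_mul_add (by omega)]; exact hl2)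
    rw [boxVolume_mul_add hj, ← hb] at h2
    rw [h2, show b + r - (b + l) = r - l by omega]
    omega

/-! ### Sorting sections and stacking daisies -/

theorem exists_antitone_enumeration (K : Finset ℤ) (f : ℤ → ℕ) :
    ∃ σ : Fin #K → ℤ, Function.Injective σ ∧ univ.image σ = K ∧ Antitone (f ∘ σ) := by
  let τ : Fin #K → ℤ := fun i => K.equivFin.symm i
  have hτ : Function.Injective τ := Subtype.val_injective.comp K.equivFin.symm.injective
  let π := Tuple.sort (OrderDual.toDual ∘ f ∘ τ)
  have hinj : Function.Injective (τ ∘ π) := hτ.comp π.injective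
  refine ⟨τ ∘ π, hinj, ?_, fun i j h => ?_⟩
  · refine eq_of_subset_of_card_le (fun k hk => ?_) ?_
    · obtain ⟨i, _, rfl⟩ := mem_image.mp hk
      exact (K.equivFin.symm (π i)).2
    · rw [card_image_of_injective _ hinj, card_univ, Fintype.card_fin]
  · exact Tuple.monotone_sort (OrderDual.toDual ∘ f ∘ τ) h

section Stack

variable {d : ℕ}

/-- The set whose section in direction `s` at height `i + 1` is the daisy with `a i` points, for
`i < n`. -/
def daisyStack (s : Fin (d + 1)) (n : ℕ) (a : ℕ → ℕ) : Finset (Fin (d + 1) → ℤ) :=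
  (range n).biUnion fun i => (daisy d (a i)).image (s.insertNth (α := fun _ => ℤ) (i + 1 : ℤ))

variable {s : Fin (d + 1)} {n : ℕ} {a : ℕ → ℕ}

theorem mem_daisyStack {x : Fin (d + 1) → ℤ} :
    x ∈ daisyStack s n a ↔ ∃ i < n, x s = i + 1 ∧ s.removeNth x ∈ daisy d (a i) := by
  simp only [daisyStack, mem_biUnion, mem_range, mem_image_insertNth]

theorem sectionAt_daisyStack {i : ℕ} (hi : i < n) :
    sectionAt s (i + 1) (daisyStack s n a) = daisy d (a i) := by
  ext y
  rw [mem_sectionAt, mem_daisyStack]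
  simp only [Fin.insertNth_apply_same, Fin.removeNth_insertNth, add_left_inj, Nat.cast_inj]
  exact ⟨by rintro ⟨_, _, rfl, h⟩; exact h, fun h => ⟨i, hi, rfl, h⟩⟩

theorem sum_daisyStack_heights (f : ℤ → ℕ) :
    ∑ k ∈ (range n).image (fun i : ℕ => (i + 1 : ℤ)), f k = ∑ i ∈ range n, f (i + 1) :=
  sum_image fun i _ j _ h => by simpa using h

theorem daisyStack_height_mem {x : Fin (d + 1) → ℤ} (hx : x ∈ daisyStack s n a) :
    x s ∈ (range n).image (fun i : ℕ => (i + 1 : ℤ)) := by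
  obtain ⟨i, hi, h, _⟩ := mem_daisyStack.mp hx
  exact mem_image.2 ⟨i, mem_range.2 hi, h.symm⟩

theorem card_daisyStack (ha : ∀ i < n, #(daisy d (a i)) = a i) :
    #(daisyStack s n a) = ∑ i ∈ range n, a i := by
  rw [← sum_card_sectionAt (fun x => daisyStack_height_mem), sum_daisyStack_heights]
  refine sum_congr rfl fun i hi => ?_
  rw [sectionAt_daisyStack (mem_range.mp hi), ha i (mem_range.mp hi)]

/-- Daisies are nested, so consecutive sections of the stack overlap in the whole smaller one. -/
theorem le_innerEdges_daisyStack (ha : ∀ i < n + 1, #(daisy d (a i)) = a i)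
    (hanti : ∀ i < n, a (i + 1) ≤ a i) :
    ∑ i ∈ range (n + 1), daisyEdges d (a i) + ∑ i ∈ range n, a (i + 1) ≤
      innerEdges (daisyStack s (n + 1) a) := by
  rw [innerEdges_eq_sum_sectionAt (fun x => daisyStack_height_mem), sum_daisyStack_heights,
    sum_daisyStack_heights]
  refine add_le_add (sum_le_sum fun i hi => ?_) ?_
  · rw [mem_range] at hi
    rw [sectionAt_daisyStack hi, innerEdges_daisy (ha i hi)]
  · rw [sum_range_succ _ n]
    refine (sum_le_sum fun i hi => ?_).trans (Nat.le_add_right _ _)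
    rw [mem_range] at hi
    have := sectionAt_daisyStack (s := s) (a := a) (show i + 1 < n + 1 by omega)
    push_cast at this
    rw [sectionAt_daisyStack (by omega), this, inter_eq_right.2 (daisy_mono d (hanti i hi)),
      ha _ (by omega)]

variable {A : Finset (Fin (d + 1) → ℤ)}

theorem sum_card_sections {σ : Fin n → ℤ} (hσ : Function.Injective σ)
    (ha : ∀ i : Fin n, a i = #(sectionAt s (σ i) A)) (f : ℕ → ℕ) :
    ∑ k ∈ univ.image σ, f #(sectionAt s k A) = ∑ i ∈ range n, f (a i) := by
  rw [sum_image fun i _ j _ h => hσ h, ← Fin.sum_univ_eq_sum_range (fun i => f (a i))]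
  exact sum_congr rfl fun i _ => by rw [ha]

/-- If daisies maximize the number of inner edges one dimension below, then stacking daisies
does not decrease the number of inner edges. -/
theorem innerEdges_le_sum_sections
    (hiso : ∀ B : Finset (Fin d → ℤ), innerEdges B ≤ daisyEdges d #B)
    {σ : Fin (n + 1) → ℤ} (hσ : Function.Injective σ) (hK : univ.image σ = A.image (· s))
    (ha : ∀ i : Fin (n + 1), a i = #(sectionAt s (σ i) A)) :
    innerEdges A ≤ ∑ i ∈ range (n + 1), daisyEdges d (a i) + ∑ i ∈ range n, a (i + 1) := by
  have hmem : ∀ x ∈ A, x s ∈ univ.image σ := fun x hx => by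
    rw [hK]; exact mem_image_of_mem _ hx
  rw [innerEdges_eq_sum_sectionAt hmem]
  refine add_le_add ?_ ?_
  · rw [← sum_card_sections hσ ha]
    exact sum_le_sum fun k _ => hiso _
  · have h1 := sum_card_inter_add_card_le hmem (mem_image_of_mem σ (mem_univ 0))
    rw [← sum_card_sectionAt hmem, sum_card_sections hσ ha fun x => x, sum_range_succ',
      ← ha 0] at h1
    simpa using h1

end Stack

/-! ### The edge-isoperimetric inequality -/

/-- A projected section lies in the product of the coordinate projections of `A`. -/
theorem card_sectionAt_le {d : ℕ} {s : Fin (d + 1)} {A : Finset (Fin (d + 1) → ℤ)} {n : ℕ}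
    (hn : ∀ i, #(A.image (· i)) ≤ n) (k : ℤ) : #(sectionAt s k A) ≤ n ^ d := by
  have hsub : sectionAt s k A ⊆ Fintype.piFinset fun i => A.image (· (s.succAbove i)) := by
    intro y hy
    rw [Fintype.mem_piFinset]
    exact fun i => mem_image.2 ⟨_, mem_sectionAt.mp hy, by simp⟩
  refine (card_le_card hsub).trans ?_
  rw [Fintype.card_piFinset]
  refine (prod_le_prod' fun i _ => hn _).trans ?_
  simp

/-- The edge-isoperimetric inequality on the lattice: daisies maximize the number of inner edges
among the sets with a given number of points. -/
theorem innerEdges_le_daisyEdges {d : ℕ} (A : Finset (Fin d → ℤ)) :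
    innerEdges A ≤ daisyEdges d #A := by
  induction d using Nat.strong_induction_on with
  | _ d ihd =>
  obtain _ | d := d
  · simp [innerEdges]
  induction hn : #A using Nat.strong_induction_on generalizing A with
  | _ n ihn =>
  rcases le_or_gt n 1 with h1 | h1
  · rw [innerEdges_eq_zero_of_card_le_one (by omega)]; omega
  -- Maximality of the number of sections gives the bound `m ≤ k ^ d` required to split off the
  -- smallest section.
  obtain ⟨s, -, hs⟩ := exists_max_image univ (fun i : Fin (d + 1) => #(A.image (· i)))
    univ_nonempty
  obtain ⟨σ, hσ, hK, hanti⟩ :=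
    exists_antitone_enumeration (A.image (· s)) fun k => #(sectionAt s k A)
  have hpos : 0 < #(A.image (· s)) :=
    card_pos.2 ((card_pos.mp (by omega)).image _)
  have hsec := fun k => card_sectionAt_le (s := s) (fun i => hs i (mem_univ i)) k
  generalize #(A.image (· s)) = q at *
  obtain ⟨q, rfl⟩ : ∃ q', q = q' + 1 := ⟨q - 1, by omega⟩
  let a : ℕ → ℕ := fun i => #(sectionAt s (σ (Fin.ofNat (q + 1) i)) A)
  have ha : ∀ i : Fin (q + 1), a i = #(sectionAt s (σ i) A) := fun i => by
    simp [a]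
  have hle : ∀ i j, i ≤ j → j ≤ q → a j ≤ a i := fun i j hij hj => by
    have := hanti (show (⟨i, by omega⟩ : Fin (q + 1)) ≤ ⟨j, by omega⟩ from hij)
    simp only [Function.comp_apply, ← ha] at this
    exact this
  have hcard : ∀ i, #(daisy d (a i)) = a i := fun i => card_daisy_card _
  have hsum : ∑ i ∈ range (q + 1), a i = n := by
    rw [← hn, ← sum_card_sections hσ ha fun x => x]
    exact sum_card_sectionAt fun x hx => by rw [hK]; exact mem_image_of_mem _ hx
  have hmk : a q ≤ (q + 1) ^ d := hsec _
  have hkm : (q + 1) * a q ≤ n := by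
    rw [← hsum]
    calc (q + 1) * a q = ∑ _i ∈ range (q + 1), a q := by simp
      _ ≤ _ := sum_le_sum fun i hi => hle i q (by rw [mem_range] at hi; omega) le_rfl
  have hapos : 0 < a q := by
    refine card_pos.2 (sectionAt_nonempty_iff.2 ?_)
    rw [← hK]
    exact mem_image_of_mem _ (mem_univ _)
  -- With one section in the direction of maximum, every coordinate projection is a single point,
  -- contradicting `1 < n`.
  obtain _ | q := q
  · simp only [zero_add, one_pow, range_one, sum_singleton] at hmk hsum
    omega
  have hmn : a (q + 1) < n := by nlinarith
  rw [sum_range_succ] at hsum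
  have hstack := card_daisyStack (s := s) (n := q + 1) (a := a) fun i _ => hcard i
  have hlow := le_innerEdges_daisyStack (s := s) (n := q) (a := a) (fun i _ => hcard i)
    fun i hi => hle i (i + 1) (by omega) (by omega)
  have hup := innerEdges_le_sum_sections (ihd d (by omega)) hσ hK ha
  rw [sum_range_succ _ (q + 1), sum_range_succ (fun i => a (i + 1)) q] at hup
  have hind := ihn (n - a (q + 1)) (by omega) (daisyStack s (q + 1) a) (by omega)
  have hlayer := daisyEdges_layer_le (fun e he => ihd e (by omega)) hmk hkm hmn
  omega

/-! ### Daisies are the initial segments -/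

theorem valueChange_levelTuple (d N : ℕ) :
    valueChange (levelTuple (d + 1) N) = growthPos d N := by
  have key : ∀ j : Fin d, levelTuple (d + 1) N j.succ < levelTuple (d + 1) N j.castSucc ↔
      (j : ℕ) + 1 = N % (d + 1) := by
    intro j
    simp only [levelTuple, Fin.val_succ, Fin.val_castSucc]
    split_ifs <;> omega
  unfold valueChange
  split_ifs with h
  · ext
    exact (key _).mp (Fin.find_spec h)
  · ext
    by_contra hne
    have hlt := (growthPos d N).2
    simp only [growthPos, Fin.val_zero] at hne hlt
    exact h ⟨⟨N % (d + 1) - 1, by omega⟩, (key _).mpr (by simp only; omega)⟩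

theorem isDO1_levelTuple {d N : ℕ} (h : d ≤ N) : IsDO1 (levelTuple d N) where
  pos := levelTuple_pos h
  antitone i j hij := by
    have : (i : ℕ) ≤ j := hij
    unfold levelTuple; split_ifs <;> omega
  osc i j := by unfold levelTuple; split_ifs <;> omega

theorem IsDO1.exists_eq_levelTuple {d : ℕ} {p : Fin d → ℕ} (hp : IsDO1 p) :
    ∃ N, d ≤ N ∧ p = levelTuple d N := by
  obtain _ | d := d
  · exact ⟨0, le_rfl, Subsingleton.elim _ _⟩
  set a := p (Fin.last d) with ha
  have hex : ∃ j, ∃ h : j < d + 1, p ⟨j, h⟩ = a := ⟨d, by omega, rfl⟩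
  obtain ⟨hj, hja⟩ := Nat.find_spec hex
  have hmin := fun j => Nat.find_min hex (m := j)
  set j := Nat.find hex
  -- `a` is the last entry and `j` the number of entries equal to `a + 1`.
  refine ⟨(d + 1) * a + j, ?_, funext fun i => ?_⟩
  · have := hp.pos (Fin.last d)
    nlinarith
  · rw [levelTuple_mul_add hj.le]
    have h1 : a ≤ p i := hp.antitone (Fin.le_last i)
    split_ifs with hij
    · have h2 := hp.osc i (Fin.last d)
      have h3 : p i ≠ a := fun h => hmin i hij ⟨i.2, h⟩
      omega
    · exact le_antisymm ((hp.antitone (not_lt.mp hij)).trans_eq hja) h1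

theorem coe_daisy_add {d N r : ℕ} (hr : r ≤ boxVolume d (faceIndex d N)) :
    (daisy (d + 1) (boxVolume (d + 1) N + r) : Set (Fin (d + 1) → ℤ)) =
      daisyBox (levelTuple (d + 1) N) ∪
        (fun x => (valueChange (levelTuple (d + 1) N)).insertNth (α := fun _ => ℤ)
          (levelTuple (d + 1) N (valueChange (levelTuple (d + 1) N)) + 1 : ℤ) x) ''
            (daisy d r : Set (Fin d → ℤ)) := by
  rw [daisy_add hr, valueChange_levelTuple, levelTuple_growthPos, ← coe_levelBox, coe_union,
    coe_image]

/-- The bound `m < boxVolume d (N + 1)` makes the induction work: strictness in `TupleLT` puts the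
layer's level below that of the facet, so the layer does not fill the facet. -/
theorem IsDaisyWith.exists_eq_daisy {d : ℕ} {p : Fin d → ℕ} {Q : Set (Fin d → ℤ)}
    (hQ : IsDaisyWith p Q) :
    ∃ N m, p = levelTuple d N ∧ Q = daisy d m ∧ #(daisy d m) = m ∧
      (0 < d → m < boxVolume d (N + 1)) := by
  induction hQ with
  | @perfect d p hp =>
    obtain ⟨N, hN, rfl⟩ := hp.exists_eq_levelTuple
    refine ⟨N, boxVolume d N, rfl, ?_, ?_, fun hd => ?_⟩
    · rw [daisy_boxVolume, coe_levelBox]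
    · rw [daisy_boxVolume, card_levelBox]
    · obtain ⟨d, rfl⟩ : ∃ e, d = e + 1 := ⟨d - 1, by omega⟩
      have := boxVolume_pos (le_faceIndex (show d ≤ N by omega))
      rw [boxVolume_succ]; omega
  | @layer d p hp q R hR hlt ih =>
    obtain ⟨N, hN, rfl⟩ := hp.exists_eq_levelTuple
    obtain ⟨M, m, rfl, rfl, hm, hlt'⟩ := ih
    obtain ⟨i, hi⟩ := hlt.2
    rw [valueChange_levelTuple, levelTuple_succAbove] at hi
    have hMN : M < faceIndex d N := by
      by_contra! h
      exact absurd (levelTuple_mono d i h) (not_le.2 hi)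
    have hmv : m < boxVolume d (faceIndex d N) :=
      (hlt' i.pos).trans_le (boxVolume_mono d hMN)
    refine ⟨N, boxVolume (d + 1) N + m, rfl, ?_, card_daisy_succ _ _, fun _ => ?_⟩
    · rw [coe_daisy_add hmv.le]
    · rw [boxVolume_succ]; omega

theorem IsDaisy.eq_daisy {d m : ℕ} {Q : Set (Fin d → ℤ)} (hQ : IsDaisy Q) (hm : Q.encard = m) :
    Q = daisy d m := by
  obtain ⟨p, hp⟩ := hQ
  obtain ⟨N, n, -, rfl, hn, -⟩ := hp.exists_eq_daisy
  rw [Set.encard_coe_eq_coe_finsetCard, hn] at hm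
  rw [Nat.cast_inj.mp hm]

/-- The bound `boxVolume d N ≤ n` is carried along to give the converse: a layer with fewer points
than the facet has strictly smaller leading coefficients. -/
theorem exists_isDaisyWith_daisy {d n : ℕ} (hn : 0 < n) (hcard : #(daisy d n) = n) :
    ∃ N, boxVolume d N ≤ n ∧ IsDaisyWith (levelTuple d N) (daisy d n : Set (Fin d → ℤ)) := by
  induction d generalizing n with
  | zero =>
    have h1 : n ≤ 1 := by
      rw [← hcard]; exact card_le_one.2 fun _ _ _ _ => Subsingleton.elim _ _
    obtain rfl : n = 1 := by omega
    refine ⟨0, by rw [boxVolume_zero_left], ?_⟩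
    have := daisy_boxVolume 0 0
    rw [boxVolume_zero_left] at this
    rw [this, coe_levelBox]
    exact .perfect _ (isDO1_levelTuple le_rfl)
  | succ d ih =>
    obtain ⟨N, r, hr, rfl⟩ := exists_eq_boxVolume_add d n
    have hN : d + 1 ≤ N := by
      by_contra! h
      have h1 := boxVolume_mono (d + 1) (show N + 1 ≤ d + 1 by omega)
      rw [boxVolume_succ_self, boxVolume_succ] at h1
      omega
    refine ⟨N, Nat.le_add_right _ _, ?_⟩
    rcases r.eq_zero_or_pos with rfl | hr0
    · rw [add_zero, daisy_boxVolume, coe_levelBox]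
      exact .perfect _ (isDO1_levelTuple hN)
    have hcr : #(daisy d r) = r := by
      obtain _ | d := d
      · rw [boxVolume_zero_left] at hr; omega
      · exact card_daisy_succ d r
    obtain ⟨M, hM, hMd⟩ := ih hr0 hcr
    have hMN : M < faceIndex d N := by
      by_contra! h
      have := boxVolume_mono d h
      omega
    rw [coe_daisy_add hr.le]
    refine .layer _ (isDO1_levelTuple hN) _ _ hMd ?_
    unfold TupleLT
    simp only [valueChange_levelTuple, levelTuple_succAbove]
    refine ⟨fun i => levelTuple_mono d i hMN.le, ?_⟩
    by_contra! h
    have : boxVolume d (faceIndex d N) ≤ boxVolume d M := prod_le_prod' fun i _ => h i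
    omega

theorem isDaisy_daisy {d n : ℕ} (hn : 0 < n) (hcard : #(daisy d n) = n) :
    IsDaisy (daisy d n : Set (Fin d → ℤ)) :=
  let ⟨N, _, h⟩ := exists_isDaisyWith_daisy hn hcard
  ⟨levelTuple d N, h⟩

/-! ### Perimeter in terms of inner edges -/

section Perimeter

variable {d : ℕ}

theorem sum_sq_eq_one_iff {z : Fin d → ℤ} :
    ∑ i, z i ^ 2 = 1 ↔ ∃ i, ∃ ε ∈ ({1, -1} : Finset ℤ), z = Pi.single i ε := by
  constructor
  · intro h
    obtain ⟨i, hi⟩ : ∃ i, z i ≠ 0 := by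
      by_contra! h0
      simp [h0] at h
    have hsq : 0 < z i ^ 2 := by positivity
    rw [← add_sum_erase _ _ (mem_univ i)] at h
    have hnn : ∀ k ∈ univ.erase i, 0 ≤ z k ^ 2 := fun k _ => sq_nonneg _
    have hzero : ∑ k ∈ univ.erase i, z k ^ 2 = 0 := by
      have := sum_nonneg hnn
      omega
    rw [sum_eq_zero_iff_of_nonneg hnn] at hzero
    refine ⟨i, z i, ?_, funext fun k => ?_⟩
    · have : z i ^ 2 = 1 := by
        have := sum_nonneg hnn
        omega
      simpa using mul_self_eq_one_iff.mp ((sq _).symm.trans this)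
    · by_cases hk : k = i
      · subst hk; simp
      · simpa [hk] using hzero k (by simp [hk])
  · rintro ⟨i, ε, hε, rfl⟩
    rw [sum_eq_single i (fun k _ hk => by simp [hk]) (by simp)]
    simp only [mem_insert, mem_singleton] at hε
    rcases hε with rfl | rfl <;> simp

theorem card_filter_sub_single (A : Finset (Fin d → ℤ)) (i : Fin d) :
    #{x ∈ A | x + Pi.single i (-1) ∈ A} = #{x ∈ A | x + Pi.single i 1 ∈ A} := by
  refine card_nbij' (· + Pi.single i (-1)) (· + Pi.single i 1) ?_ ?_ ?_ ?_
  · intro x hx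
    simp only [coe_filter, Set.mem_ofPred_eq] at hx ⊢
    exact ⟨hx.2, by simpa [Pi.single_neg] using hx.1⟩
  · intro x hx
    simp only [coe_filter, Set.mem_ofPred_eq] at hx ⊢
    exact ⟨hx.2, by simpa [Pi.single_neg] using hx.1⟩
  · intro x _; simp [Pi.single_neg]
  · intro x _; simp [Pi.single_neg]

/-- Of the `2 * d * #A` ordered pairs of neighbours starting in `A`, each inner edge accounts for
two that stay in `A`. -/
theorem edgePerimeter_coe (A : Finset (Fin d → ℤ)) :
    edgePerimeter (A : Set (Fin d → ℤ)) = (2 * (d * #A - innerEdges A) : ℕ) := by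
  classical
  let T : Finset (Fin d × ℤ × (Fin d → ℤ)) :=
    {t ∈ univ ×ˢ ({1, -1} : Finset ℤ) ×ˢ A | t.2.2 + Pi.single t.1 t.2.1 ∉ A}
  have hinj : Set.InjOn (fun t : Fin d × ℤ × (Fin d → ℤ) => (t.2.2, t.2.2 + Pi.single t.1 t.2.1))
      T := by
    rintro ⟨i, ε, x⟩ h ⟨i', ε', x'⟩ h' heq
    simp only [T, coe_filter, mem_product, Set.mem_ofPred_eq] at h h'
    simp only [Prod.mk.injEq] at heq
    obtain ⟨rfl, heq⟩ := heq
    have heq := add_left_cancel heq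
    have hε : ε ≠ 0 := by
      rintro rfl
      simp at h
    have hi : i = i' := by
      by_contra hne
      have := congrFun heq i
      simp [hne] at this
      exact hε this
    subst hi
    have := congrFun heq i
    simp only [Pi.single_eq_same] at this
    rw [this]
  have himage : edgeBoundary (A : Set (Fin d → ℤ)) =
      T.image fun t => (t.2.2, t.2.2 + Pi.single t.1 t.2.1) := by
    ext ⟨x, y⟩
    simp only [edgeBoundary, Set.mem_ofPred_eq, mem_coe, mem_image, T, mem_filter, mem_product,
      mem_univ, true_and, Prod.mk.injEq, Prod.exists]
    constructor
    · rintro ⟨h, hx, hy⟩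
      have h' : ∑ i, (y - x) i ^ 2 = 1 := by
        rw [← h]; exact sum_congr rfl fun i _ => by simp only [Pi.sub_apply]; ring
      obtain ⟨i, ε, hε, hz⟩ := sum_sq_eq_one_iff.mp h'
      have hyx : x + Pi.single i ε = y := by rw [← hz]; abel
      exact ⟨i, ε, x, ⟨⟨hε, hx⟩, by rwa [hyx]⟩, rfl, hyx⟩
    · rintro ⟨i, ε, _, ⟨⟨hε, hx⟩, hy⟩, rfl, rfl⟩
      refine ⟨?_, hx, hy⟩
      rw [← sum_sq_eq_one_iff.mpr ⟨i, ε, hε, rfl⟩]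
      exact sum_congr rfl fun k _ => by simp only [Pi.add_apply]; ring
  rw [edgePerimeter, himage, Set.encard_coe_eq_coe_finsetCard, card_image_of_injOn hinj]
  congr 1
  have hT : #T = ∑ i, (#{x ∈ A | x + Pi.single i 1 ∉ A} + #{x ∈ A | x + Pi.single i (-1) ∉ A}) := by
    simp only [T, card_filter, sum_product]
    refine sum_congr rfl fun i _ => ?_
    rw [sum_insert (by simp), sum_singleton]
  have hcompl : ∀ i (ε : ℤ), #{x ∈ A | x + Pi.single i ε ∈ A} +
      #{x ∈ A | x + Pi.single i ε ∉ A} = #A := fun i ε => card_filter_add_card_filter_not _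
  have hsum : #T + 2 * innerEdges A = 2 * (d * #A) := by
    rw [hT, innerEdges, mul_sum, ← sum_add_distrib]
    have : ∀ i ∈ (univ : Finset (Fin d)), #{x ∈ A | x + Pi.single i 1 ∉ A} +
        #{x ∈ A | x + Pi.single i (-1) ∉ A} + 2 * #{x ∈ A | x + Pi.single i 1 ∈ A} = 2 * #A := by
      intro i _
      have h1 := hcompl i 1
      have h2 := hcompl i (-1)
      rw [card_filter_sub_single] at h2
      omega
    rw [sum_congr rfl this]
    simp; ring
  omega

end Perimeter

/-! ### Decreasing rearrangements as stacks of daisies -/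

section Rearrangement

variable {d : ℕ} {s : Fin (d + 1)} {A : Finset (Fin (d + 1) → ℤ)}

theorem removeNth_image_latticeSection (s : Fin (d + 1)) (k : ℤ) (C : Set (Fin (d + 1) → ℤ)) :
    s.removeNth '' latticeSection s k C = {y | s.insertNth (α := fun _ => ℤ) k y ∈ C} := by
  ext y
  constructor
  · rintro ⟨x, ⟨hx, rfl⟩, rfl⟩
    simpa using hx
  · intro hy
    exact ⟨_, ⟨hy, by simp⟩, by simp⟩

theorem latticeSection_coe_nonempty {k : ℤ} :
    (latticeSection s k (A : Set (Fin (d + 1) → ℤ))).Nonempty ↔ k ∈ A.image (· s) := by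
  simp [latticeSection, Set.Nonempty]

theorem encard_latticeSection_coe (k : ℤ) :
    (latticeSection s k (A : Set (Fin (d + 1) → ℤ))).encard = #(sectionAt s k A) := by
  have : latticeSection s k (A : Set (Fin (d + 1) → ℤ)) =
      (({x ∈ A | x s = k} : Finset (Fin (d + 1) → ℤ)) : Set (Fin (d + 1) → ℤ)) := by
    ext x; simp [latticeSection]
  rw [this, Set.encard_coe_eq_coe_finsetCard, card_sectionAt]

/-- The sizes of the sections of `A` listed by `σ`, continued by zero. -/
noncomputable def sectionSizes (s : Fin (d + 1)) (A : Finset (Fin (d + 1) → ℤ)) {n : ℕ}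
    (σ : Fin n → ℤ) (i : ℕ) : ℕ := if h : i < n then #(sectionAt s (σ ⟨i, h⟩) A) else 0

theorem sectionSizes_coe {n : ℕ} (σ : Fin n → ℤ) (i : Fin n) :
    sectionSizes s A σ i = #(sectionAt s (σ i) A) := by
  simp [sectionSizes]

theorem card_daisy_sectionSizes {n : ℕ} (σ : Fin n → ℤ) (i : ℕ) :
    #(daisy d (sectionSizes s A σ i)) = sectionSizes s A σ i := by
  unfold sectionSizes
  split_ifs
  · exact card_daisy_card _
  · simp [daisy_zero_right]

/-- The decreasing rearrangements of a finite set are the stacks of daisies whose sizes are those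
of the sections, listed in decreasing order. -/
theorem isDecreasingRearrangement_coe_iff {C' : Set (Fin (d + 1) → ℤ)} :
    IsDecreasingRearrangement s (A : Set (Fin (d + 1) → ℤ)) C' ↔
      ∃ (n : ℕ) (σ : Fin n → ℤ), Function.Injective σ ∧ univ.image σ = A.image (· s) ∧
        Antitone (fun i => #(sectionAt s (σ i) A)) ∧
        C' = daisyStack s n (sectionSizes s A σ) := by
  constructor
  · rintro ⟨n, σ, hanti, hheight, hsec⟩
    refine ⟨n, fun i => σ i, Subtype.val_injective.comp σ.injective, ?_, fun i j hij => ?_, ?_⟩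
    · ext k
      rw [← latticeSection_coe_nonempty, mem_image]
      exact ⟨by rintro ⟨i, -, rfl⟩; exact (σ i).2, fun h => ⟨σ.symm ⟨k, h⟩, mem_univ _, by simp⟩⟩
    · have := hanti i j hij
      rw [encard_latticeSection_coe, encard_latticeSection_coe] at this
      exact_mod_cast this
    · have hdaisy : ∀ i : Fin n, s.removeNth '' latticeSection s ((i : ℤ) + 1) C' =
          daisy d (sectionSizes s A (fun i => (σ i : ℤ)) i) := fun i => by
        refine (hsec i).1.eq_daisy ?_
        rw [(hsec i).2, encard_latticeSection_coe, sectionSizes_coe]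
      ext x
      rw [mem_coe, mem_daisyStack]
      constructor
      · intro hx
        have hk := (hheight (x s)).mp ⟨x, hx, rfl⟩
        have hi : (x s - 1).toNat < n := by omega
        have hxs : x s = ((x s - 1).toNat : ℤ) + 1 := by omega
        refine ⟨(x s - 1).toNat, hi, hxs, ?_⟩
        rw [← mem_coe, ← hdaisy ⟨_, hi⟩]
        exact ⟨x, ⟨hx, hxs⟩, rfl⟩
      · rintro ⟨i, hi, hxs, hx⟩
        rw [← mem_coe, ← hdaisy ⟨i, hi⟩, removeNth_image_latticeSection] at hx
        simp only [Set.mem_ofPred_eq, ← hxs, Fin.insertNth_self_removeNth] at hx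
        exact hx
  · rintro ⟨n, σ, hσ, hK, hanti, rfl⟩
    have hmem : ∀ i, σ i ∈ A.image (· s) := fun i => by
      rw [← hK]; exact mem_image_of_mem _ (mem_univ i)
    have hpos : ∀ i : Fin n, 0 < sectionSizes s A σ i := fun i => by
      rw [sectionSizes_coe]; exact card_pos.2 (sectionAt_nonempty_iff.2 (hmem i))
    have hdaisy : ∀ i : Fin n, s.removeNth '' latticeSection s ((i : ℤ) + 1)
        (daisyStack s n (sectionSizes s A σ)) = (daisy d (sectionSizes s A σ i) : Set _) :=
      fun i => by
        rw [removeNth_image_latticeSection, ← sectionAt_daisyStack (s := s) i.2]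
        ext y
        rw [mem_coe, mem_sectionAt]
        rfl
    refine ⟨n, Equiv.ofBijective (fun i => ⟨σ i, latticeSection_coe_nonempty.2 (hmem i)⟩)
      ⟨fun i j h => hσ (congrArg Subtype.val h), fun k => ?_⟩, fun i j hij => ?_, fun k => ?_,
      fun i => ?_⟩
    · obtain ⟨k, hk⟩ := k
      rw [latticeSection_coe_nonempty, ← hK] at hk
      obtain ⟨i, -, rfl⟩ := mem_image.mp hk
      exact ⟨i, rfl⟩
    · simp only [encard_latticeSection_coe]
      exact_mod_cast hanti hij
    · constructor
      · rintro ⟨x, hx, rfl⟩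
        obtain ⟨i, hi, h, -⟩ := mem_daisyStack.mp (mem_coe.mp hx)
        omega
      · rintro ⟨h1, h2⟩
        obtain ⟨i, rfl⟩ : ∃ i : ℕ, k = i + 1 := ⟨(k - 1).toNat, by omega⟩
        have hi : i < n := by omega
        rw [← Set.image_nonempty (f := s.removeNth), hdaisy ⟨i, hi⟩, coe_nonempty, ← card_pos,
          card_daisy_sectionSizes]
        exact hpos ⟨i, hi⟩
    · rw [hdaisy i]
      refine ⟨isDaisy_daisy (hpos i) (card_daisy_sectionSizes σ i), ?_⟩
      rw [encard_latticeSection_coe, Set.encard_coe_eq_coe_finsetCard, card_daisy_sectionSizes,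
        sectionSizes_coe]
      rfl

/-- Sections of equal size may be listed in several orders, but the sorted list of sizes is the same
for all of them. -/
theorem sectionSizes_unique {n n' : ℕ} {σ : Fin n → ℤ} {σ' : Fin n' → ℤ}
    (hσ : Function.Injective σ) (hσ' : Function.Injective σ')
    (himage : univ.image σ = univ.image σ')
    (hanti : Antitone fun i => #(sectionAt s (σ i) A))
    (hanti' : Antitone fun i => #(sectionAt s (σ' i) A)) :
    n = n' ∧ sectionSizes s A σ = sectionSizes s A σ' := by
  obtain rfl : n = n' := by
    have := congrArg card himage
    simpa [card_image_of_injective _ hσ, card_image_of_injective _ hσ'] using this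
  refine ⟨rfl, ?_⟩
  have hex : ∀ i, ∃ j, σ j = σ' i := fun i => by
    have : σ' i ∈ univ.image σ := by rw [himage]; exact mem_image_of_mem _ (mem_univ i)
    simpa using this
  choose π hπ using hex
  have hinj : Function.Injective π := fun i j h => hσ' (by rw [← hπ, ← hπ, h])
  let τ := Equiv.ofBijective π (Finite.injective_iff_bijective.mp hinj)
  have key := Tuple.unique_monotone (σ := Equiv.refl _) (τ := τ)
    (f := fun i => OrderDual.toDual #(sectionAt s (σ i) A)) (fun i j h => hanti h)
    (fun i j h => by
      have := hanti' h
      simp only [← hπ] at this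
      exact this)
  funext i
  unfold sectionSizes
  split_ifs with hi
  · rw [← hπ]
    exact congrFun key ⟨i, hi⟩
  · rfl

theorem innerEdges_le_innerEdges_daisyStack {n : ℕ} {σ : Fin n → ℤ} (hA : A.Nonempty)
    (hσ : Function.Injective σ) (hK : univ.image σ = A.image (· s))
    (hanti : Antitone fun i => #(sectionAt s (σ i) A)) :
    innerEdges A ≤ innerEdges (daisyStack s n (sectionSizes s A σ)) := by
  obtain _ | n := n
  · have := hA.image (· s)
    rw [← hK] at this
    simp at this
  · refine (innerEdges_le_sum_sections innerEdges_le_daisyEdges hσ hK (sectionSizes_coe σ)).trans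
      (le_innerEdges_daisyStack (fun i _ => card_daisy_sectionSizes σ i) fun i hi => ?_)
    have := hanti (show (⟨i, by omega⟩ : Fin (n + 1)) ≤ ⟨i + 1, by omega⟩ from Nat.le_succ i)
    simpa only [← sectionSizes_coe] using this

theorem card_daisyStack_sectionSizes {n : ℕ} {σ : Fin n → ℤ}
    (hσ : Function.Injective σ) (hK : univ.image σ = A.image (· s)) :
    #(daisyStack s n (sectionSizes s A σ)) = #A := by
  rw [card_daisyStack fun i _ => card_daisy_sectionSizes σ i,
    ← sum_card_sections hσ (sectionSizes_coe σ) fun x => x]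
  exact sum_card_sectionAt fun x hx => by rw [hK]; exact mem_image_of_mem _ hx

end Rearrangement

theorem proposition3p2 {d : ℕ} (C : Set (Fin (d + 1) → ℤ)) (hne : C.Nonempty)
    (hC : Bornology.IsBounded C) (s : Fin (d + 1)) :
    (∃! C' : Set (Fin (d + 1) → ℤ), IsDecreasingRearrangement s C C') ∧
      ∀ C' : Set (Fin (d + 1) → ℤ), IsDecreasingRearrangement s C C' →
        edgePerimeter C' ≤ edgePerimeter C := by
  -- Closed balls are compact and the lattice is discrete, so bounded sets are finite.
  have hfin : C.Finite := by
    obtain ⟨r, hr⟩ := (Metric.isBounded_iff_subset_closedBall 0).1 hC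
    exact (isCompact_closedBall 0 r).finite_of_discrete.subset hr
  obtain ⟨A, rfl⟩ := hfin.exists_finset_coe
  simp only [isDecreasingRearrangement_coe_iff]
  refine ⟨?_, ?_⟩
  · obtain ⟨σ, hσ, hK, hanti⟩ :=
      exists_antitone_enumeration (A.image (· s)) fun k => #(sectionAt s k A)
    refine ⟨_, ⟨_, σ, hσ, hK, hanti, rfl⟩, ?_⟩
    rintro _ ⟨n', σ', hσ', hK', hanti', rfl⟩
    obtain ⟨rfl, h⟩ := sectionSizes_unique hσ' hσ (hK'.trans hK.symm) hanti' hanti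
    rw [h]
  · rintro _ ⟨n, σ, hσ, hK, hanti, rfl⟩
    rw [edgePerimeter_coe, edgePerimeter_coe, card_daisyStack_sectionSizes hσ hK]
    have := innerEdges_le_innerEdges_daisyStack (coe_nonempty.mp hne) hσ hK hanti
    exact_mod_cast Nat.mul_le_mul_left 2 (Nat.sub_le_sub_left this _)
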